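/- Let $\mathcal{O}$ be an oriented matroid on a finite ground set $E$, given by its set $\mathcal{C}$ of signed cocircuits, and let $z(X)$ denote the zero set of a sign vector $X$. Two cocircuits $X \neq \pm Y$ are comodular if $z(X\circ Y)$ is a coline (a flat of corank $2$) of the underlying matroid. For distinct $g,f\in E$, where $g$ is not a loop and $f$ is not a coloop, the directed cocircuit graph $G_f$ of the oriented matroid program $(\mathcal{O},g,f)$ has as vertices the cocircuits $X$ with $X_g=+$ and as edges the pairs of conformal, comodular such cocircuits. An edge $(X,Y)$ is directed $X\to Y$, directed $X\leftarrow Y$, or undirected, if the cocircuit $Z$ obtained by cocircuit elimination of $g$ between $-X$ and $Y$ satisfies $Z_f=+$, $Z_f=-$, or $Z_f=0$, respectively. A directed cycle in $G_f$ is a closed path $P^0,\dots,P^n=P^0$ with $P^0,\dots,P^{n-1}$ pairwise distinct such that each edge $(P^i,P^{i+1})$ is directed $P^i\to P^{i+1}$ or undirected, and at least one of them is directed. The program $(\mathcal{O},g,f)$ is Euclidean if $G_f$ contains no directed cycle, and $\mathcal{O}$ is Euclidean if all programs $(\mathcal{O},g,f)$ with $g\neq f$, $g$ not a loop and $f$ not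 a coloop are Euclidean. For an ordered subset $[e_1,\dots,e_k]$ of $E$ and signs $\alpha_1,\dots,\alpha_k\in\{+,-\}$, the lexicographic extension $\mathcal{O}[e_1^{\alpha_1},\dots,e_k^{\alpha_k}]$ is the single-element extension $\mathcal{O}\cup p$ (with $(\mathcal{O}\cup p)\setminus p=\mathcal{O}$ and $p$ not a coloop) in which $(Y,\sigma(Y))$ is a cocircuit for every $Y\in\mathcal{C}$, where $\sigma(Y)=\alpha_iY_{e_i}$ for the smallest $i$ with $Y_{e_i}\neq 0$, and $\sigma(Y)=0$ if there is no such $i$. **Theorem.** Let $\mathcal{O}$ be a Euclidean oriented matroid with ground set $E$ and let $\mathcal{O}\cup p$ be a lexicographic extension of $\mathcal{O}$. Then for every $f\in E$ the program $(\mathcal{O}\cup p,p,f)$, with the new element $p$ as the hyperplane at infinity, is Euclidean, i.e. its directed cocircuit graph contains no directed cycle. (This includes the degenerate cases in which $p$ is a loop or $f$ is a coloop of $\mathcal{O}\cup p$.) -/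

import Mathlib

/-- An oriented matroid with ground set `E`, given by its signed cocircuits: a set of sign vectors
that satisfies the (co)circuit axioms of oriented matroids. -/
@[ext]
structure OrientedMatroid (E : Type*) where
  /-- The set of signed cocircuits. -/
  cocircuits : Set (E → SignType)
  zero_notMem : (0 : E → SignType) ∉ cocircuits
  neg_mem : ∀ X ∈ cocircuits, -X ∈ cocircuits
  incomparable : ∀ X ∈ cocircuits, ∀ Y ∈ cocircuits,
    (∀ e, X e ≠ 0 → Y e ≠ 0) → X = Y ∨ X = -Y
  elimination : ∀ X ∈ cocircuits, ∀ Y ∈ cocircuits, X ≠ -Y → ∀ e, X e = 1 → Y e = -1 →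
    ∃ Z ∈ cocircuits, Z e = 0 ∧
      (∀ h, Z h = 1 → X h = 1 ∨ Y h = 1) ∧ (∀ h, Z h = -1 → X h = -1 ∨ Y h = -1)

namespace OrientedMatroid

variable {E : Type*}

/-- The support of a sign vector. -/
def supp (X : E → SignType) : Set E := {e | X e ≠ 0}

/-- The zero set of a sign vector. -/
def zeroSet (X : E → SignType) : Set E := {e | X e = 0}

/-- The separation set of two sign vectors: the elements on which they have opposite nonzero
signs. -/
def sep (X Y : E → SignType) : Set E := {e | X e ≠ 0 ∧ X e = -Y e}

/-- The composition `X ∘ Y` of two sign vectors. -/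
def comp (X Y : E → SignType) : E → SignType := fun e => if X e = 0 then Y e else X e

/-- Elimination for the supports of the cocircuits. -/
theorem exists_supp_subset_of_mem (O : OrientedMatroid E) {X Y : E → SignType}
    (hX : X ∈ O.cocircuits) (hY : Y ∈ O.cocircuits) (hne : supp X ≠ supp Y) {e : E}
    (heX : e ∈ supp X) (heY : e ∈ supp Y) :
    ∃ Z ∈ O.cocircuits, supp Z ⊆ (supp X ∪ supp Y) \ {e} := by
  have key : ∀ X ∈ O.cocircuits, ∀ Y ∈ O.cocircuits, supp X ≠ supp Y → X e = 1 → Y e = -1 →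
      ∃ Z ∈ O.cocircuits, supp Z ⊆ (supp X ∪ supp Y) \ {e} := by
    intro X hX Y hY hne h1 h2
    obtain ⟨Z, hZ, hZe, hp, hm⟩ := O.elimination X hX Y hY
      (by rintro rfl; exact hne (by ext; simp [supp])) e h1 h2
    refine ⟨Z, hZ, fun h hh => ⟨?_, ?_⟩⟩
    · rcases SignType.trichotomy (Z h) with h' | h' | h'
      · rcases hm h h' with h' | h' <;> simp [supp, h']
      · exact absurd h' hh
      · rcases hp h h' with h' | h' <;> simp [supp, h']
    · rintro rfl
      exact hh hZe
  have hs : ∀ X : E → SignType, supp (-X) = supp X := fun X => by ext; simp [supp]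
  rcases SignType.trichotomy (X e) with h1 | h1 | h1
  · rcases SignType.trichotomy (Y e) with h2 | h2 | h2
    · simpa [hs] using key (-X) (O.neg_mem X hX) Y hY (by simpa [hs] using hne) (by simp [h1]) h2
    · exact absurd h2 heY
    · simpa [hs] using key (-X) (O.neg_mem X hX) (-Y) (O.neg_mem Y hY) (by simpa [hs] using hne)
        (by simp [h1]) (by simp [h2])
  · exact absurd h1 heX
  · rcases SignType.trichotomy (Y e) with h2 | h2 | h2
    · exact key X hX Y hY hne h1 h2
    · exact absurd h2 heY
    · simpa [hs] using key X hX (-Y) (O.neg_mem Y hY) (by simpa [hs] using hne) h1 (by simp [h2])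

/-- Augmentation for the sets that contain no support of a cocircuit. -/
theorem exists_insert_of_ncard_lt [Finite E] (O : OrientedMatroid E) {I J : Set E}
    (hI : ∀ X ∈ O.cocircuits, ¬ supp X ⊆ I) (hJ : ∀ X ∈ O.cocircuits, ¬ supp X ⊆ J)
    (hIJ : I.ncard < J.ncard) :
    ∃ e ∈ J, e ∉ I ∧ ∀ X ∈ O.cocircuits, ¬ supp X ⊆ insert e I := by
  by_contra! hcon
  let S : Set (Set E) :=
    {K | K ⊆ I ∪ J ∧ I.ncard < K.ncard ∧ ∀ X ∈ O.cocircuits, ¬ supp X ⊆ K}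
  obtain ⟨K, ⟨hKs, hKc, hKi⟩, hmin⟩ :=
    Set.exists_min_image S (fun K => (I \ K).ncard) (Set.toFinite S)
      ⟨J, Set.subset_union_right, hIJ, hJ⟩
  obtain ⟨e, heI, heK⟩ : ∃ e ∈ I, e ∉ K := by
    by_contra! hsub
    obtain ⟨x, hxK, hxI⟩ := Set.exists_mem_notMem_of_ncard_lt_ncard hKc
    obtain ⟨X, hX, hXs⟩ := hcon x ((hKs hxK).resolve_left hxI) hxI
    exact hKi X hX (hXs.trans (Set.insert_subset hxK hsub))
  have hC : ∀ x ∈ K, x ∉ I → ∃ X ∈ O.cocircuits, supp X ⊆ insert e K \ {x} := by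
    intro x hxK hxI
    by_contra! hno
    have hex : e ≠ x := fun h => hxI (h ▸ heI)
    have hmem : insert e K \ {x} ∈ S := by
      refine ⟨?_, ?_, hno⟩
      · exact Set.sdiff_subset.trans (Set.insert_subset (Or.inl heI) hKs)
      · rw [Set.ncard_sdiff_singleton_of_mem (Set.mem_insert_of_mem _ hxK),
          Set.ncard_insert_of_notMem heK]
        simpa using hKc
    have hlt : (I \ (insert e K \ {x})).ncard < (I \ K).ncard := by
      refine Set.ncard_lt_ncard ?_ (Set.toFinite _)
      refine ⟨?_, fun h => ?_⟩
      · rintro y ⟨hyI, hy⟩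
        refine ⟨hyI, fun hyK => hy ⟨Set.mem_insert_of_mem _ hyK, ?_⟩⟩
        rintro rfl
        exact hxI hyI
      · exact (h ⟨heI, heK⟩).2 ⟨Set.mem_insert _ _, hex⟩
    exact absurd (hmin _ hmem) (not_le.mpr hlt)
  have heC : ∀ X ∈ O.cocircuits, supp X ⊆ insert e K → e ∈ supp X := by
    intro X hX hs
    by_contra he
    exact hKi X hX fun y hy => (hs hy).resolve_left (by rintro rfl; exact he hy)
  obtain ⟨g, hgK, hgI⟩ := Set.exists_mem_notMem_of_ncard_lt_ncard hKc
  obtain ⟨X, hX, hXs⟩ := hC g hgK hgI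
  obtain ⟨h, hhX, hhI⟩ := Set.not_subset.mp (hI X hX)
  have hhK : h ∈ K := (hXs hhX).1.resolve_left (by rintro rfl; exact hhI heI)
  obtain ⟨Y, hY, hYs⟩ := hC h hhK hhI
  have hne : supp X ≠ supp Y := fun heq => (hYs (heq ▸ hhX)).2 rfl
  have hXs' := hXs.trans Set.sdiff_subset
  have hYs' := hYs.trans Set.sdiff_subset
  obtain ⟨Z, hZ, hZs⟩ := O.exists_supp_subset_of_mem hX hY hne (heC X hX hXs') (heC Y hY hYs')
  refine hKi Z hZ fun y hy => ?_
  obtain ⟨hy1, hy2⟩ := hZs hy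
  exact (hy1.elim (fun h => hXs' h) (fun h => hYs' h)).resolve_left hy2

/-- The dual of the underlying matroid: a set is independent if it contains no support of a
cocircuit, so that the circuits are the supports of the cocircuits. -/
noncomputable def dualMatroid [Finite E] (O : OrientedMatroid E) : Matroid E :=
  (IndepMatroid.ofFinite (E := Set.univ) Set.finite_univ
    (fun I => ∀ X ∈ O.cocircuits, ¬ supp X ⊆ I)
    (fun X hX h => O.zero_notMem (by
      have : X = 0 := funext fun e => by_contra fun he => h he
      exact this ▸ hX))
    (fun _ _ hJ hIJ X hX h => hJ X hX (h.trans hIJ))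
    (fun _ _ hI hJ hlt => O.exists_insert_of_ncard_lt hI hJ hlt)
    (fun _ _ => Set.subset_univ _)).matroid

/-- The underlying matroid `M(O)`, whose cocircuits are the supports of the cocircuits of `O`. -/
noncomputable def matroid [Finite E] (O : OrientedMatroid E) : Matroid E := O.dualMatroid✶

/-- The cocircuits of the underlying matroid are the supports of the signed cocircuits. -/
theorem isCocircuit_matroid_iff [Finite E] (O : OrientedMatroid E) (K : Set E) :
    O.matroid.IsCocircuit K ↔ ∃ X ∈ O.cocircuits, K = supp X := by
  have hind : ∀ I, O.dualMatroid.Indep I ↔ ∀ X ∈ O.cocircuits, ¬ supp X ⊆ I := fun I => by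
    simp [dualMatroid, IndepMatroid.ofFinite_indep]
  have hE : O.dualMatroid.E = Set.univ := rfl
  rw [Matroid.isCocircuit_def, matroid, Matroid.dual_dual, Matroid.isCircuit_def]
  have hdep : ∀ I, O.dualMatroid.Dep I ↔ ∃ X ∈ O.cocircuits, supp X ⊆ I := fun I => by
    rw [Matroid.Dep, hind, hE]; simp
  constructor
  · intro h
    obtain ⟨X, hX, hs⟩ := (hdep K).1 h.prop
    exact ⟨X, hX, (hs.antisymm (h.le_of_le ((hdep _).2 ⟨X, hX, subset_rfl⟩) hs)).symm⟩
  · rintro ⟨X, hX, rfl⟩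
    refine ⟨(hdep _).2 ⟨X, hX, subset_rfl⟩, fun J hJ hJX => ?_⟩
    obtain ⟨Y, hY, hs⟩ := (hdep J).1 hJ
    have : supp Y = supp X := by
      rcases O.incomparable Y hY X hX (fun e he => (hs.trans hJX) he) with rfl | rfl
      · rfl
      · ext; simp [supp]
    exact this ▸ hs

/-- A coline of a matroid: a flat whose rank is two less than the rank of the matroid. -/
def IsColine (M : Matroid E) (F : Set E) : Prop := M.IsFlat F ∧ M.eRk F + 2 = M.eRank

/-- `X` and `Y` are distinct (up to sign) comodular cocircuits: the zero set of `X ∘ Y` is a coline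
of the underlying matroid, so that `X ∘ Y` is an edge. -/
def Comodular [Finite E] (O : OrientedMatroid E) (X Y : E → SignType) : Prop :=
  X ∈ O.cocircuits ∧ Y ∈ O.cocircuits ∧ IsColine O.matroid (zeroSet (comp X Y))

/-- `(X, Y)` is an edge of the cocircuit graph of `(O, g)`: its ends are comodular conformal
cocircuits, and both lie in the affine space, on the positive side of `g`. -/
def IsEdge [Finite E] (O : OrientedMatroid E) (g : E) (X Y : E → SignType) : Prop :=
  O.Comodular X Y ∧ sep X Y = ∅ ∧ X g = 1 ∧ Y g = 1

/-- `Z` results from cocircuit elimination of `g` between `X` and `Y`. -/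
def IsElimination (O : OrientedMatroid E) (g : E) (X Y Z : E → SignType) : Prop :=
  Z ∈ O.cocircuits ∧ Z g = 0 ∧
    (∀ h, Z h = 1 → X h = 1 ∨ Y h = 1) ∧ (∀ h, Z h = -1 → X h = -1 ∨ Y h = -1)

/-- `X → Y` in the program `(O, g, f)`, for comodular cocircuits with `X g = Y g ≠ 0`. -/
def DirectedTo (O : OrientedMatroid E) (g f : E) (X Y : E → SignType) : Prop :=
  ∃ Z, O.IsElimination g (-X) Y Z ∧ Z f = 1

/-- `X ↔ Y` in the program `(O, g, f)`, for comodular cocircuits with `X g = Y g ≠ 0`. -/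
def Undirected (O : OrientedMatroid E) (g f : E) (X Y : E → SignType) : Prop :=
  ∃ Z, O.IsElimination g (-X) Y Z ∧ Z f = 0

/-- `P 0, …, P n` is a directed cycle of the graph `G_f` of the program `(O, g, f)`: a closed path
without repeated vertices, all of whose edges are directed forwards or undirected, and at least one
of them directed. -/
def IsDirectedCycle [Finite E] (O : OrientedMatroid E) (g f : E) (n : ℕ)
    (P : ℕ → E → SignType) : Prop :=
  P 0 = P n ∧ (∀ i < n, ∀ j < n, P i = P j → i = j) ∧
    (∀ i < n, O.IsEdge g (P i) (P (i + 1))) ∧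
    (∀ i < n, O.DirectedTo g f (P i) (P (i + 1)) ∨ O.Undirected g f (P i) (P (i + 1))) ∧
    ∃ i < n, O.DirectedTo g f (P i) (P (i + 1))

/-- The program `(O, g, f)` is Euclidean: its directed cocircuit graph `G_f` contains no directed
cycle. -/
def IsEuclideanProgram [Finite E] (O : OrientedMatroid E) (g f : E) : Prop :=
  ∀ n P, ¬ O.IsDirectedCycle g f n P

/-- An oriented matroid is Euclidean if all its programs `(O, g, f)` (where `g ≠ f`, `g` is not a
loop and `f` is not a coloop) are Euclidean. -/
def IsEuclidean [Finite E] (O : OrientedMatroid E) : Prop :=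
  ∀ g f : E, g ≠ f → ¬ O.matroid.IsLoop g → ¬ O.matroid.IsColoop f → O.IsEuclideanProgram g f

/-- The restriction of a sign vector on `E ∪ p` to `E`; the new element `p` is `none`. -/
def restrict (X : Option E → SignType) : E → SignType := fun e => X (some e)

/-- The sign vector `(Y, s)` on `E ∪ p` with restriction `Y` and value `s` at the new element. -/
def extend (Y : E → SignType) (s : SignType) : Option E → SignType := fun x => x.elim s Y

/-- `O` is the deletion `O' \ p` of the new element `p`: its cocircuits are the nonzero
restrictions of cocircuits of `O'` that have minimal support. -/
def IsDeletion (O : OrientedMatroid E) (O' : OrientedMatroid (Option E)) : Prop :=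
  ∀ Y : E → SignType, Y ∈ O.cocircuits ↔
    (∃ X ∈ O'.cocircuits, restrict X = Y) ∧ Y ≠ 0 ∧
      ∀ X ∈ O'.cocircuits, restrict X ≠ 0 → supp (restrict X) ⊆ supp Y →
        supp (restrict X) = supp Y

/-- `O' = O ∪ p` is a single-element extension of `O` by an element `p` that is not a coloop, and
`σ` is its localization: `(Y, σ Y)` is a cocircuit of `O'` for every cocircuit `Y` of `O`. -/
def IsExtensionBy [Finite E] (O : OrientedMatroid E) (O' : OrientedMatroid (Option E))
    (σ : (E → SignType) → SignType) : Prop :=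
  O.IsDeletion O' ∧ ¬ O'.matroid.IsColoop none ∧
    ∀ Y ∈ O.cocircuits, extend Y (σ Y) ∈ O'.cocircuits

/-- The localization of the lexicographic extension `O[e₁^α₁, …, e_k^α_k]`: the value is
`αᵢ Y(eᵢ)` for the first `i` with `Y(eᵢ) ≠ 0`, and `0` if there is no such `i`. -/
def lexLocalization : List (E × SignType) → (E → SignType) → SignType
  | [], _ => 0
  | (e, α) :: l, Y => if Y e = 0 then lexLocalization l Y else α * Y e

/-- `O'` is a lexicographic extension of `O`: the extension by the lexicographic localization of
some ordered set `[e₁, …, e_k]` of elements and some signs `α₁, …, α_k ∈ {+, -}`. -/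
def IsLexicographicExtension [Finite E] (O : OrientedMatroid E)
    (O' : OrientedMatroid (Option E)) : Prop :=
  ∃ l : List (E × SignType), (l.map Prod.fst).Nodup ∧ (∀ x ∈ l, x.2 ≠ 0) ∧
    O.IsExtensionBy O' (lexLocalization l)

end OrientedMatroid

/-!
The theorem reduces to one symmetry on each edge of the graph, the exchange of `p` and `f`.

Let `P` be a directed cycle of the program `(O ∪ p, p, f)`. Cocircuits on a coline are determined up
to sign by a zero outside the coline (`Comodular.eq_or_eq_neg`). Hence `P i f ≤ P (i + 1) f` along
every edge that is not directed backwards (`IsEdge.apply_le_apply`), so `P i f` has a constant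
value `s` on the cycle, and `s ≠ 0` because otherwise no edge is directed.

On the coline through an edge `(X, Y)`, let `Z` be the cocircuit obtained from `-X` and `Y` by
elimination of `p`, and `F` the one obtained by elimination of `f`. As `p` and `f` are both constant
and nonzero on the edge, `Z f = -s * F p` (`IsEdge.apply_elimination`): of the zeros of `p` and
`f` between `-X` and `Y`, either both coincide or one comes first. Now `F` may be chosen as `(F', σ
F')` with `F'` obtained by elimination of `f` in `O`, where `σ` is the lexicographic localization.
So `σ F'` has a weak sign along the whole cycle, and is nonzero on some edge.

But the first element `e` of the lexicographic extension then has a weak sign on the `F'`, and since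
the restriction of the cycle to `O` is a closed path on one side of `f`, Euclideanness of the
program `(O, f, e)` forces `F' e = 0` on all edges (`IsEuclidean.elimination_apply_eq_zero`).
The same argument applies to the second element, and so on, so `σ F' = 0` on all edges, a
contradiction.
-/

namespace OrientedMatroid

variable {E : Type*}

/-! ### Sign vectors and elimination -/

theorem zeroSet_comp (X Y : E → SignType) : zeroSet (comp X Y) = zeroSet X ∩ zeroSet Y := by
  ext e
  change (if X e = 0 then Y e else X e) = 0 ↔ X e = 0 ∧ Y e = 0
  split_ifs with h <;> simp [h]

theorem sep_eq_empty_iff {X Y : E → SignType} : sep X Y = ∅ ↔ ∀ e, X e ≠ 0 → X e ≠ -Y e := by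
  simp [sep, Set.eq_empty_iff_forall_notMem]

theorem isElimination_iff {O : OrientedMatroid E} {g : E} {X Y Z : E → SignType} :
    O.IsElimination g X Y Z ↔
      Z ∈ O.cocircuits ∧ Z g = 0 ∧ ∀ h, Z h ≠ 0 → Z h = X h ∨ Z h = Y h := by
  unfold IsElimination
  refine and_congr_right fun _ => and_congr_right fun _ => ⟨?_, ?_⟩
  · rintro ⟨h1, h2⟩ h hh
    rcases SignType.trichotomy (Z h) with hz | hz | hz
    · rcases h2 h hz with h | h <;> simp [hz, h]
    · exact absurd hz hh
    · rcases h1 h hz with h | h <;> simp [hz, h]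
  · intro H
    refine ⟨fun h hh => ?_, fun h hh => ?_⟩
    · have := H h (by simp [hh])
      rw [hh] at this
      exact this.imp Eq.symm Eq.symm
    · have := H h (by simp [hh])
      rw [hh] at this
      exact this.imp Eq.symm Eq.symm

theorem exists_isElimination (O : OrientedMatroid E) {X Y : E → SignType} (hX : X ∈ O.cocircuits)
    (hY : Y ∈ O.cocircuits) (hne : X ≠ -Y) {e : E} (he : X e ≠ 0) (heY : X e = -Y e) :
    ∃ Z, O.IsElimination e X Y Z := by
  rcases SignType.trichotomy (X e) with h | h | h
  · obtain ⟨Z, hZ, h0, hp, hm⟩ := O.elimination Y hY X hX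
      (by rintro rfl; exact hne (neg_neg X).symm) e (by rw [← neg_neg (Y e), ← heY, h]; rfl) h
    exact ⟨Z, hZ, h0, fun k hk => (hp k hk).symm, fun k hk => (hm k hk).symm⟩
  · exact absurd h he
  · obtain ⟨Z, hZ, h0, hp, hm⟩ := O.elimination X hX Y hY hne e h
      (by rw [← neg_neg (Y e), ← heY, h])
    exact ⟨Z, hZ, h0, hp, hm⟩

theorem IsElimination.neg {O : OrientedMatroid E} {g : E} {X Y Z : E → SignType}
    (h : O.IsElimination g X Y Z) : O.IsElimination g (-X) (-Y) (-Z) := by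
  rw [isElimination_iff] at h ⊢
  refine ⟨O.neg_mem _ h.1, by simp [h.2.1], fun k hk => ?_⟩
  simpa using h.2.2 k (by simpa using hk)

theorem IsElimination.symm {O : OrientedMatroid E} {g : E} {X Y Z : E → SignType}
    (h : O.IsElimination g X Y Z) : O.IsElimination g Y X Z :=
  ⟨h.1, h.2.1, fun k hk => (h.2.2.1 k hk).symm, fun k hk => (h.2.2.2 k hk).symm⟩

/-- Of two opposite cocircuits, only one can result from an elimination of `g` between `X` and `Y`:
otherwise its support would lie in that of `X`. -/
theorem IsElimination.eq_of_eq_or_eq_neg {O : OrientedMatroid E} {g : E} {X Y Z W : E → SignType}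
    (hX : X ∈ O.cocircuits) (hg : X g ≠ 0) (hZ : O.IsElimination g X Y Z)
    (hW : O.IsElimination g X Y W) (h : Z = W ∨ Z = -W) : Z = W := by
  refine h.resolve_right ?_
  rintro rfl
  rw [isElimination_iff] at hZ hW
  have hs : ∀ k, W k ≠ 0 → X k ≠ 0 := by
    intro k hk hXk
    have h1 := hW.2.2 k hk
    have h2 := hZ.2.2 k (by simpa using hk)
    rw [hXk] at h1 h2
    have h1' := h1.resolve_left hk
    have h2' := h2.resolve_left (by simpa using hk)
    rw [Pi.neg_apply, ← h1'] at h2'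
    revert hk h2'
    generalize W k = a
    decide +revert
  have := hW.2.1
  rcases O.incomparable W hW.1 X hX hs with rfl | rfl
  · exact hg this
  · exact hg (by simpa using this)

/-! ### Flats and colines of the underlying matroid -/

theorem matroid_ground [Finite E] (O : OrientedMatroid E) : O.matroid.E = Set.univ := rfl

theorem subset_matroid_ground [Finite E] (O : OrientedMatroid E) (S : Set E) : S ⊆ O.matroid.E :=
  Set.subset_univ S

theorem spanning_matroid_iff [Finite E] (O : OrientedMatroid E) (S : Set E) :
    O.matroid.Spanning S ↔ ∀ X ∈ O.cocircuits, ∃ e ∈ S, X e ≠ 0 := by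
  rw [Matroid.spanning_iff_compl_coindep (O.subset_matroid_ground S),
    Matroid.coindep_iff_forall_subset_not_isCocircuit]
  simp only [isCocircuit_matroid_iff, matroid_ground]
  constructor
  · rintro ⟨h, -⟩ X hX
    by_contra! hc
    exact h (supp X) (fun e he => ⟨trivial, fun heS => he (hc e heS)⟩) ⟨X, hX, rfl⟩
  · refine fun h => ⟨?_, Set.sdiff_subset⟩
    rintro _ hK ⟨X, hX, rfl⟩
    obtain ⟨e, heS, he⟩ := h X hX
    exact (hK he).2 heS

/-- The zero set of a cocircuit is a flat. -/
theorem eq_zero_of_mem_closure [Finite E] (O : OrientedMatroid E) {V : E → SignType}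
    (hV : V ∈ O.cocircuits) {S : Set E} (hS : S ⊆ zeroSet V) {h : E}
    (hh : h ∈ O.matroid.closure S) : V h = 0 := by
  by_contra hne
  obtain ⟨C, hCs, hC, hhC⟩ :=
    (Matroid.mem_closure_iff_exists_isCircuit (fun hS' => hne (hS hS'))).1 hh
  refine hC.inter_isCocircuit_ne_singleton (K := supp V) (e := h)
    ((O.isCocircuit_matroid_iff _).2 ⟨V, hV, rfl⟩) ?_
  ext x
  constructor
  · rintro ⟨hx, hxV⟩
    exact (hCs hx).resolve_right fun hxS => hxV (hS hxS)
  · rintro rfl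
    exact ⟨hhC, hne⟩

theorem eRk_ne_top [Finite E] (M : Matroid E) (S : Set E) : M.eRk S ≠ ⊤ :=
  ((M.eRk_le_encard S).trans_lt (Set.toFinite S).encard_lt_top).ne

theorem Comodular.symm [Finite E] {O : OrientedMatroid E} {X Y : E → SignType}
    (h : O.Comodular X Y) : O.Comodular Y X :=
  ⟨h.2.1, h.1, by rw [zeroSet_comp, Set.inter_comm, ← zeroSet_comp]; exact h.2.2⟩

theorem Comodular.neg [Finite E] {O : OrientedMatroid E} {X Y : E → SignType}
    (h : O.Comodular X Y) : O.Comodular (-X) (-Y) := by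
  refine ⟨O.neg_mem _ h.1, O.neg_mem _ h.2.1, ?_⟩
  have : ∀ X : E → SignType, zeroSet (-X) = zeroSet X := fun X => by ext; simp [zeroSet]
  rw [zeroSet_comp, this, this, ← zeroSet_comp]
  exact h.2.2

/-- A hyperplane is not a coline. -/
theorem Comodular.ne [Finite E] {O : OrientedMatroid E} {X Y : E → SignType}
    (h : O.Comodular X Y) : X ≠ Y := by
  rintro rfl
  obtain ⟨hX, -, -, hr⟩ := h
  rw [zeroSet_comp, Set.inter_self] at hr
  obtain ⟨e, he⟩ : ∃ e, X e ≠ 0 := by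
    by_contra! hc
    exact O.zero_notMem ((funext hc : X = 0) ▸ hX)
  have hs : O.matroid.Spanning (insert e (zeroSet X)) := by
    rw [spanning_matroid_iff]
    intro Y hY
    by_contra! hc
    have hYe := hc e (Set.mem_insert _ _)
    rcases O.incomparable Y hY X hX
      (fun k hk hXk => hk (hc k (Set.mem_insert_of_mem _ hXk))) with rfl | rfl
    · exact he hYe
    · exact he (by simpa using hYe)
  have h1 := O.matroid.eRk_insert_le_add_one e (zeroSet X)
  rw [hs.eRk_eq, ← hr] at h1
  have h2 := eRk_ne_top O.matroid (zeroSet X)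
  generalize O.matroid.eRk (zeroSet X) = a at h1 h2
  lift a to ℕ using h2
  norm_cast at h1
  omega

/-- Two cocircuits on the coline of `X` and `Y` with a common zero outside the coline agree up to
sign. -/
theorem Comodular.eq_or_eq_neg [Finite E] {O : OrientedMatroid E} {X Y V W : E → SignType}
    (h : O.Comodular X Y) (hV : V ∈ O.cocircuits) (hW : W ∈ O.cocircuits)
    (hVl : ∀ k, X k = 0 → Y k = 0 → V k = 0) (hWl : ∀ k, X k = 0 → Y k = 0 → W k = 0) {e : E}
    (he : X e ≠ 0 ∨ Y e ≠ 0) (hVe : V e = 0) (hWe : W e = 0) : V = W ∨ V = -W := by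
  obtain ⟨-, -, hF, hr⟩ := h
  rw [zeroSet_comp] at hF hr
  set F := zeroSet X ∩ zeroSet Y
  have heF : e ∉ F := fun hh => he.elim (fun h => h hh.1) (fun h => h hh.2)
  have hVF : insert e F ⊆ zeroSet V :=
    Set.insert_subset hVe fun k hk => hVl k hk.1 hk.2
  have hWF : insert e F ⊆ zeroSet W :=
    Set.insert_subset hWe fun k hk => hWl k hk.1 hk.2
  refine O.incomparable V hV W hW fun k hk hWk => ?_
  by_cases hkc : k ∈ O.matroid.closure (insert e F)
  · exact hk (O.eq_zero_of_mem_closure hV hVF hkc)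
  · have h1 : O.matroid.eRk (insert e F) = O.matroid.eRk F + 1 :=
      Matroid.eRk_insert_eq_add_one ⟨trivial, by rwa [hF.closure]⟩
    have h2 : O.matroid.eRk (insert k (insert e F)) = O.matroid.eRk (insert e F) + 1 :=
      Matroid.eRk_insert_eq_add_one ⟨trivial, hkc⟩
    have hs : O.matroid.Spanning (insert k (insert e F)) := by
      have : O.matroid.RankFinite := by
        rw [← Matroid.eRank_ne_top_iff, Matroid.eRank_def]
        exact eRk_ne_top _ _
      rw [Matroid.spanning_iff_eRk_le (O.subset_matroid_ground _), h2, h1, ← hr, add_assoc]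
      rfl
    obtain ⟨j, hj, hjW⟩ := (O.spanning_matroid_iff _).1 hs W hW
    exact hjW (Set.insert_subset (show k ∈ zeroSet W from hWk) hWF hj)

/-! ### Edges of the cocircuit graph -/

/-- Eliminations between `-X` and `Y` lie on the coline of `X` and `Y`. -/
theorem IsElimination.apply_eq_zero {O : OrientedMatroid E} {g : E} {X Y Z : E → SignType}
    (hZ : O.IsElimination g (-X) Y Z) {k : E} (hX : X k = 0) (hY : Y k = 0) : Z k = 0 := by
  by_contra hk
  rcases (isElimination_iff.1 hZ).2.2 k hk with h | h
  · exact hk (by simp [h, hX])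
  · exact hk (h.trans hY)

/-- Along an edge that is not directed backwards, the sign of `f` does not decrease. -/
theorem IsEdge.apply_le_apply [Finite E] {O : OrientedMatroid E} {p f : E} {X Y Z : E → SignType}
    (h : O.IsEdge p X Y) (hZ : O.IsElimination p (-X) Y Z) (hf : Z f ≠ -1) : X f ≤ Y f := by
  obtain ⟨hc, hs, hX, hY⟩ := h
  have hsf := sep_eq_empty_iff.1 hs f
  have key : ∀ V ∈ O.cocircuits, V p = 1 → (∀ k, X k = 0 → Y k = 0 → V k = 0) →
      (X f ≠ 0 ∨ Y f ≠ 0) → V f = 0 → Z f ≠ 0 := by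
    intro V hV hVp hVl hXY hVf hZf
    have hZp := hZ.2.1
    rcases hc.eq_or_eq_neg hV hZ.1 hVl (fun k => hZ.apply_eq_zero) hXY hVf hZf with rfl | rfl
    · simp [hVp] at hZp
    · simp [hZp] at hVp
  have kX := key X hc.1 hX (fun _ h _ => h)
  have kY := key Y hc.2.1 hY (fun _ _ h => h)
  have hZf := (isElimination_iff.1 hZ).2.2 f
  rw [Pi.neg_apply] at hZf
  revert hsf kX kY hZf hf
  generalize X f = a, Y f = b, Z f = c
  decide +revert

/-- If `p` and `f` are both constant and nonzero on an edge `(X, Y)`, then the value of `f` at the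
zero of `p` is opposite to the value of `p` at the zero of `f`, up to the sign of `f`. -/
theorem IsEdge.apply_elimination [Finite E] {O : OrientedMatroid E} {p f : E}
    {X Y Z F : E → SignType} {s : SignType} (h : O.IsEdge p X Y) (hs : s ≠ 0) (hXf : X f = s)
    (hYf : Y f = s) (hZ : O.IsElimination p (-X) Y Z) (hF : O.IsElimination f (-X) Y F) :
    Z f = -(s * F p) := by
  obtain ⟨hc, -, hX, hY⟩ := h
  have hFi := isElimination_iff.1 hF
  have hZF : Z f = 0 ∨ F p = 0 → Z f = 0 ∧ F p = 0 := by
    rintro (h0 | h0)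
    · refine ⟨h0, ?_⟩
      rcases hc.eq_or_eq_neg hF.1 hZ.1 (fun k => hF.apply_eq_zero) (fun k => hZ.apply_eq_zero)
        (Or.inl (hXf ▸ hs)) hF.2.1 h0 with rfl | rfl
      · exact hZ.2.1
      · simp [hZ.2.1]
    · refine ⟨?_, h0⟩
      rcases hc.eq_or_eq_neg hZ.1 hF.1 (fun k => hZ.apply_eq_zero) (fun k => hF.apply_eq_zero)
        (Or.inl (by simp [hX] : X p ≠ 0)) hZ.2.1 h0 with rfl | rfl
      · exact hF.2.1
      · simp [hF.2.1]
  -- An elimination of `p` between `F` and one of `-X`, `Y` is also one between `-X` and `Y`.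
  have huniq : ∀ W, O.IsElimination p (-X) Y W → Z = W := fun W hW =>
    hZ.eq_of_eq_or_eq_neg (O.neg_mem _ hc.1) (by simp [hX]) hW
      (hc.eq_or_eq_neg hZ.1 hW.1 (fun k => hZ.apply_eq_zero) (fun k => hW.apply_eq_zero)
        (Or.inl (by simp [hX] : X p ≠ 0)) hZ.2.1 hW.2.1)
  rcases SignType.trichotomy (F p) with hp | hp | hp
  · obtain ⟨W, hW⟩ := O.exists_isElimination hF.1 hc.2.1
      (fun h => hs (by have := hF.2.1; rw [h] at this; simpa [hYf] using this)) (e := p)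
      (by simp [hp]) (by simp [hp, hY])
    have hWi := isElimination_iff.1 hW
    have hZW := huniq W (isElimination_iff.2 ⟨hWi.1, hWi.2.1, fun k hk => by
      rcases hWi.2.2 k hk with h | h
      · rw [h] at hk ⊢
        exact hFi.2.2 k hk
      · exact Or.inr h⟩)
    have hZf : Z f ≠ 0 := fun h => by simpa [hp] using (hZF (Or.inl h)).2
    have := hWi.2.2 f (hZW ▸ hZf)
    rw [← hZW, hF.2.1, hYf] at this
    rw [this.resolve_left hZf, hp]
    simp
  · rw [(hZF (Or.inr hp)).1, hp]
    simp
  · obtain ⟨W, hW⟩ := O.exists_isElimination (O.neg_mem _ hc.1) hF.1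
      (fun h => hs (by have := hF.2.1; rw [← neg_inj.1 h] at this; simpa [hXf] using this)) (e := p)
      (by simp [hX]) (by simp [hp, hX])
    have hWi := isElimination_iff.1 hW
    have hZW := huniq W (isElimination_iff.2 ⟨hWi.1, hWi.2.1, fun k hk => by
      rcases hWi.2.2 k hk with h | h
      · exact Or.inl h
      · rw [h] at hk ⊢
        exact hFi.2.2 k hk⟩)
    have hZf : Z f ≠ 0 := fun h => by simpa [hp] using (hZF (Or.inl h)).2
    have := hWi.2.2 f (hZW ▸ hZf)
    rw [← hZW, hF.2.1, Pi.neg_apply, hXf] at this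
    rw [this.resolve_right hZf, hp]
    simp

/-! ### Closed paths in Euclidean oriented matroids -/

/-- A closed path `P 0, …, P n = P 0` without repeated vertices in the graph of all cocircuits, whose
edges are the pairs of conformal comodular cocircuits. -/
structure IsClosedPath [Finite E] (O : OrientedMatroid E) (n : ℕ) (P : ℕ → E → SignType) : Prop where
  closed : P 0 = P n
  injective : ∀ i < n, ∀ j < n, P i = P j → i = j
  comodular : ∀ i < n, O.Comodular (P i) (P (i + 1))
  conformal : ∀ i < n, sep (P i) (P (i + 1)) = ∅

theorem IsClosedPath.neg [Finite E] {O : OrientedMatroid E} {n : ℕ} {P : ℕ → E → SignType}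
    (h : O.IsClosedPath n P) : O.IsClosedPath n (fun i => -P i) where
  closed := by simp [h.closed]
  injective i hi j hj hij := h.injective i hi j hj (neg_inj.1 hij)
  comodular i hi := (h.comodular i hi).neg
  conformal i hi := by
    have := sep_eq_empty_iff.1 (h.conformal i hi)
    refine sep_eq_empty_iff.2 fun e he hee => this e (by simpa using he) (neg_inj.1 hee)

theorem IsClosedPath.reverse [Finite E] {O : OrientedMatroid E} {n : ℕ} {P : ℕ → E → SignType}
    (h : O.IsClosedPath n P) : O.IsClosedPath n (fun i => P (n - i)) where
  closed := by simp [h.closed]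
  injective i hi j hj hij := by
    have key : ∀ i < n, ∃ k < n, P (n - i) = P k ∧ (i = 0 ∧ k = 0 ∨ i ≠ 0 ∧ k = n - i) := by
      intro i hi
      rcases Nat.eq_zero_or_pos i with rfl | h0
      · exact ⟨0, hi, by simp [h.closed], by simp⟩
      · exact ⟨n - i, by omega, rfl, by omega⟩
    obtain ⟨k, hk, hik, hk'⟩ := key i hi
    obtain ⟨l, hl, hjl, hl'⟩ := key j hj
    have := h.injective k hk l hl (by rw [← hik, ← hjl]; exact hij)
    omega
  comodular i hi := by
    have := (h.comodular (n - (i + 1)) (by omega)).symm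
    rwa [show n - (i + 1) + 1 = n - i by omega] at this
  conformal i hi := by
    have := sep_eq_empty_iff.1 (h.conformal (n - (i + 1)) (by omega))
    rw [show n - (i + 1) + 1 = n - i by omega] at this
    refine sep_eq_empty_iff.2 fun e he hee => this e ?_ ?_
    · rw [hee] at he
      simpa using he
    · rw [hee, neg_neg]

/-- If `f` is constant and nonzero on a closed path of a Euclidean oriented matroid, and the
eliminations of `f` along the path have a weak sign at `e`, then they vanish at `e`. The excluded
programs with `e = f` or with a coloop `e` need no hypothesis: there the eliminations vanish
trivially. -/
theorem IsEuclidean.elimination_apply_eq_zero [Finite E] {O : OrientedMatroid E}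
    (hO : O.IsEuclidean) {f e : E} {n : ℕ} {P F : ℕ → E → SignType} {s t : SignType}
    (hP : O.IsClosedPath n P) (hs : s ≠ 0) (ht : t ≠ 0) (hf : ∀ i ≤ n, P i f = s)
    (hF : ∀ i < n, O.IsElimination f (-P i) (P (i + 1)) (F i))
    (he : ∀ i < n, F i e ≠ 0 → F i e = t) : ∀ i < n, F i e = 0 := by
  have pos : ∀ {P F : ℕ → E → SignType}, O.IsClosedPath n P → (∀ i ≤ n, P i f = 1) →
      (∀ i < n, O.IsElimination f (-P i) (P (i + 1)) (F i)) →
      (∀ i < n, F i e ≠ 0 → F i e = 1) → ∀ i < n, F i e = 0 := by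
    intro P F hP hf hF he
    by_contra! hc
    obtain ⟨i, hi, hie⟩ := hc
    have hfe : f ≠ e := by
      rintro rfl
      exact hie (hF i hi).2.1
    refine hO f e hfe ?_ ?_ n P ⟨hP.closed, hP.injective, fun i hi => ?_, fun i hi => ?_, i, hi,
      F i, hF i hi, he i hi hie⟩
    · intro hl
      have hK := (O.isCocircuit_matroid_iff _).2 ⟨P i, (hP.comodular i hi).1, rfl⟩
      have := hK.isNonloop_of_mem (e := f) (by simp [supp, hf i hi.le])
      exact this.not_isLoop hl
    · intro hl
      obtain ⟨X, hX, hXs⟩ := (O.isCocircuit_matroid_iff _).1 hl.isCocircuit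
      have hXf : X f = 0 := by
        by_contra hne
        exact hfe (show f ∈ ({e} : Set E) by rw [hXs]; exact hne)
      have key : ∀ V ∈ O.cocircuits, V f = 1 → V e = 0 := by
        intro V hV hVf
        by_contra hVe
        rcases O.incomparable X hX V hV fun k hk => by
          have : k ∈ ({e} : Set E) := by rw [hXs]; exact hk
          rwa [Set.mem_singleton_iff.1 this] with rfl | rfl
        · simp [hXf] at hVf
        · simp [hVf] at hXf
      exact hie ((hF i hi).apply_eq_zero (key _ (hP.comodular i hi).1 (hf i hi.le))
        (key _ (hP.comodular i hi).2.1 (hf (i + 1) hi)))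
    · exact ⟨hP.comodular i hi, hP.conformal i hi, hf i hi.le, hf (i + 1) hi⟩
    · by_cases h0 : F i e = 0
      · exact Or.inr ⟨F i, hF i hi, h0⟩
      · exact Or.inl ⟨F i, hF i hi, he i hi h0⟩
  have one : ∀ {P F : ℕ → E → SignType} {t : SignType}, t ≠ 0 → O.IsClosedPath n P →
      (∀ i ≤ n, P i f = 1) → (∀ i < n, O.IsElimination f (-P i) (P (i + 1)) (F i)) →
      (∀ i < n, F i e ≠ 0 → F i e = t) → ∀ i < n, F i e = 0 := by
    intro P F t ht hP hf hF he
    rcases SignType.trichotomy t with rfl | rfl | rfl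
    · have := pos (F := fun i => -F (n - (i + 1))) hP.reverse (fun i _ => hf _ (by omega))
        (fun i hi => by
          have := (hF (n - (i + 1)) (by omega)).neg.symm
          rwa [neg_neg, show n - (i + 1) + 1 = n - i by omega] at this)
        (fun i hi h0 => by
          simpa using congrArg (-·) (he (n - (i + 1)) (by omega) (by simpa using h0)))
      intro i hi
      have := this (n - (i + 1)) (by omega)
      rw [show n - (n - (i + 1) + 1) = i by omega] at this
      simpa using this
    · exact absurd rfl ht
    · exact pos hP hf hF he
  rcases SignType.trichotomy s with rfl | rfl | rfl
  · have := one (F := fun i => -F i) (t := -t) (by simpa using ht) hP.neg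
      (fun i hi => by simp [hf i hi]) (fun i hi => (hF i hi).neg)
      (fun i hi h0 => by simpa using he i hi (by simpa using h0))
    simpa using this
  · exact absurd rfl hs
  · exact one ht hP hf hF he

/-- Where the values of a lexicographic localization on a family have a weak sign, its first element
has one on the family as well. Thus, if a weak sign of any single element forces that element to
vanish on the family, then so does the localization. -/
theorem lexLocalization_eq_zero {ι : Type*} {F : ι → E → SignType}
    (H : ∀ (e : E) (t : SignType), t ≠ 0 → (∀ i, F i e ≠ 0 → F i e = t) → ∀ i, F i e = 0)
    {l : List (E × SignType)} (hl : ∀ x ∈ l, x.2 ≠ 0) {t : SignType} (ht : t ≠ 0)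
    (h : ∀ i, lexLocalization l (F i) ≠ 0 → lexLocalization l (F i) = t) :
    ∀ i, lexLocalization l (F i) = 0 := by
  induction l with
  | nil => exact fun _ => rfl
  | cons x l ih =>
    obtain ⟨e, α⟩ := x
    have hα : α ≠ 0 := hl (e, α) List.mem_cons_self
    have hz : ∀ i, F i e = 0 := by
      refine H e (α * t) (mul_ne_zero hα ht) fun i hi => ?_
      have := h i
      rw [lexLocalization, if_neg hi] at this
      rw [← this (mul_ne_zero hα hi)]
      revert hα
      generalize F i e = a
      clear * -
      decide +revert
    simp only [lexLocalization, hz, if_true] at h ⊢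
    exact ih (fun x hx => hl x (List.mem_cons_of_mem _ hx)) h

/-! ### Single-element extensions -/

/-- Below every nonzero restriction of a cocircuit of `O ∪ p` there is a cocircuit of `O`. -/
theorem IsDeletion.exists_cocircuit [Finite E] {O : OrientedMatroid E}
    {O' : OrientedMatroid (Option E)} (h : O.IsDeletion O') {U : Option E → SignType}
    (hU : U ∈ O'.cocircuits) (hne : restrict U ≠ 0) :
    ∃ Y ∈ O.cocircuits, ∀ e, Y e ≠ 0 → U (some e) ≠ 0 := by
  obtain ⟨V, ⟨hV, hV0, hVU⟩, hmin⟩ := Set.exists_min_image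
    {V | V ∈ O'.cocircuits ∧ restrict V ≠ 0 ∧ supp (restrict V) ⊆ supp (restrict U)}
    (fun V => (supp (restrict V)).ncard) (Set.toFinite _) ⟨U, hU, hne, subset_rfl⟩
  refine ⟨restrict V, (h _).2 ⟨⟨V, hV, rfl⟩, hV0, fun X hX hX0 hs => ?_⟩, hVU⟩
  exact Set.eq_of_subset_of_ncard_le hs (hmin X ⟨hX, hX0, hs.trans hVU⟩) (Set.toFinite _)

theorem restrict_ne_zero [Finite E] {O' : OrientedMatroid (Option E)}
    (h : ¬ O'.matroid.IsColoop none) {V : Option E → SignType} (hV : V ∈ O'.cocircuits) :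
    restrict V ≠ 0 := by
  intro h0
  refine h (Matroid.singleton_isCocircuit.1 ((O'.isCocircuit_matroid_iff _).2 ⟨V, hV, ?_⟩))
  have hz : ∀ e, V (some e) = 0 := fun e => congrFun h0 e
  ext x
  cases x with
  | none =>
    simp only [Set.mem_singleton_iff, true_iff]
    intro hn
    refine O'.zero_notMem ((funext fun x => ?_ : V = 0) ▸ hV)
    cases x with
    | none => exact hn
    | some e => exact hz e
  | some e => simp [supp, hz e]

/-- The cocircuits of an extension that do not vanish at the new element restrict to cocircuits. -/
theorem IsExtensionBy.restrict_mem [Finite E] {O : OrientedMatroid E}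
    {O' : OrientedMatroid (Option E)} {σ : (E → SignType) → SignType} (h : O.IsExtensionBy O' σ)
    {V : Option E → SignType} (hV : V ∈ O'.cocircuits) (hp : V none ≠ 0) :
    restrict V ∈ O.cocircuits := by
  obtain ⟨hd, hc, hσ⟩ := h
  obtain ⟨Y, hY, hYV⟩ := hd.exists_cocircuit hV (restrict_ne_zero hc hV)
  rcases O'.incomparable _ (hσ Y hY) V hV fun x hx => by
    cases x with
    | none => exact hp
    | some e => exact hYV e hx with rfl | h
  · exact hY
  · have : restrict V = -Y := by
      rw [← neg_neg V, ← h]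
      rfl
    exact this ▸ O.neg_mem Y hY

/-- The underlying matroid of `O` is the deletion of the new element from that of `O ∪ p`. -/
theorem IsExtensionBy.matroid_eq_comap [Finite E] {O : OrientedMatroid E}
    {O' : OrientedMatroid (Option E)} {σ : (E → SignType) → SignType}
    (h : O.IsExtensionBy O' σ) : O.matroid = O'.matroid.comap some := by
  have hr : O'.matroid.Spanning (Set.range some) := by
    rw [spanning_matroid_iff]
    intro X hX
    obtain ⟨e, he⟩ := Function.ne_iff.1 (restrict_ne_zero h.2.1 hX)
    exact ⟨some e, ⟨e, rfl⟩, he⟩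
  have hs : ∀ S : Set E, O.matroid.Spanning S ↔ O'.matroid.Spanning (some '' S) := by
    intro S
    rw [spanning_matroid_iff, spanning_matroid_iff]
    constructor
    · intro H X hX
      obtain ⟨Y, hY, hYX⟩ := h.1.exists_cocircuit hX (restrict_ne_zero h.2.1 hX)
      obtain ⟨e, heS, he⟩ := H Y hY
      exact ⟨some e, ⟨e, heS, rfl⟩, hYX e he⟩
    · intro H Y hY
      obtain ⟨_, ⟨e, heS, rfl⟩, he⟩ := H _ (h.2.2 Y hY)
      exact ⟨e, heS, he⟩
  refine Matroid.ext_spanning rfl fun S _ => (hs S).trans ?_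
  rw [Matroid.spanning_iff_closure_eq (O'.subset_matroid_ground _),
    Matroid.spanning_iff_closure_eq (Set.subset_univ S), Matroid.comap_closure_eq]
  change _ = Set.univ ↔ _ = Set.univ
  constructor
  · intro h
    rw [h, Set.preimage_univ]
  · intro h
    have hsub : Set.range some ⊆ O'.matroid.closure (some '' S) := by
      rintro _ ⟨e, rfl⟩
      exact (h ▸ Set.mem_univ e : e ∈ some ⁻¹' _)
    have := O'.matroid.closure_subset_closure_of_subset_closure hsub
    rw [hr.closure_eq] at this
    exact Set.eq_univ_of_univ_subset this

/-- Edges of the affine space of the new element restrict to comodular pairs. -/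
theorem IsExtensionBy.comodular_restrict [Finite E] {O : OrientedMatroid E}
    {O' : OrientedMatroid (Option E)} {σ : (E → SignType) → SignType} (h : O.IsExtensionBy O' σ)
    {X Y : Option E → SignType} (hXY : O'.Comodular X Y) (hX : X none ≠ 0) (hY : Y none ≠ 0) :
    O.Comodular (restrict X) (restrict Y) := by
  obtain ⟨hXm, hYm, hF, hr⟩ := hXY
  refine ⟨h.restrict_mem hXm hX, h.restrict_mem hYm hY, ?_⟩
  have himg : zeroSet (comp X Y) = some '' zeroSet (comp (restrict X) (restrict Y)) := by
    rw [zeroSet_comp, zeroSet_comp]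
    ext x
    cases x <;> simp [zeroSet, restrict, hX]
  have hrk : O'.matroid.eRank = (O'.matroid.comap some).eRank := by
    rw [Matroid.eRank_def (O'.matroid.comap some), Matroid.eRk_comap]
    refine (Matroid.Spanning.eRk_eq ?_).symm
    rw [spanning_matroid_iff]
    intro X hX
    obtain ⟨e, he⟩ := Function.ne_iff.1 (restrict_ne_zero h.2.1 hX)
    exact ⟨some e, ⟨e, trivial, rfl⟩, he⟩
  rw [himg] at hF hr
  rw [h.matroid_eq_comap]
  refine ⟨?_, by rw [Matroid.eRk_comap, hr, hrk]⟩
  rw [Matroid.isFlat_iff_closure_eq, Matroid.comap_closure_eq, hF.closure,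
    Set.preimage_image_eq _ (Option.some_injective E)]

end OrientedMatroid

/-! ### Directed cycles of the extension -/

open OrientedMatroid in
theorem theorem1 {E : Type*} [Finite E] (O : OrientedMatroid E)
    (O' : OrientedMatroid (Option E)) (hO : O.IsEuclidean)
    (hO' : O.IsLexicographicExtension O') (f : E) :
    O'.IsEuclideanProgram none (some f) := by
  rintro n P ⟨h0, hinj, hedge, hdir, m, hm, Zm, hZm, hZmf⟩
  obtain ⟨l, -, hl, hext⟩ := hO'
  have hZ : ∀ i < n, ∃ Z, O'.IsElimination none (-P i) (P (i + 1)) Z ∧ Z (some f) ≠ -1 := by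
    intro i hi
    rcases hdir i hi with ⟨Z, hZ, hf⟩ | ⟨Z, hZ, hf⟩ <;> exact ⟨Z, hZ, by simp [hf]⟩
  choose! Z hZ hZf using hZ
  -- The sign of `f` is nondecreasing along the cycle, hence constant.
  have hmono : ∀ i j, i ≤ j → j ≤ n → P i (some f) ≤ P j (some f) := by
    intro i j hij
    induction j, hij using Nat.le_induction with
    | base => exact fun _ => le_rfl
    | succ j _ ih =>
      exact fun hj => (ih (by omega)).trans
        ((hedge j hj).apply_le_apply (hZ j hj) (hZf j hj))
  obtain ⟨s, hs⟩ : ∃ s, P 0 (some f) = s := ⟨_, rfl⟩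
  have hconst : ∀ i ≤ n, P i (some f) = s := fun i hi =>
    le_antisymm ((hmono i n hi le_rfl).trans (by rw [← h0, hs])) (hs ▸ hmono 0 i (Nat.zero_le i) hi)
  have hs0 : s ≠ 0 := by
    rintro rfl
    have := hZm.apply_eq_zero (hconst m hm.le) (hconst (m + 1) hm)
    simp [hZmf] at this
  have hPp : ∀ i ≤ n, P i none = 1 := by
    intro i hi
    rcases Nat.lt_or_ge i n with h | h
    · exact (hedge i h).2.2.1
    · rw [le_antisymm hi h, ← h0]
      exact (hedge 0 (by omega)).2.2.1
  have hpath : O.IsClosedPath n (fun i => restrict (P i)) :=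
    { closed := congrArg restrict h0
      injective := fun i hi j hj hij => hinj i hi j hj (funext fun x => by
        cases x with
        | none => rw [hPp i hi.le, hPp j hj.le]
        | some e => exact congrFun hij e)
      comodular := fun i hi => hext.comodular_restrict (hedge i hi).1
        (by simp [hPp i hi.le]) (by simp [hPp (i + 1) hi])
      conformal := fun i hi => sep_eq_empty_iff.2 fun e =>
        sep_eq_empty_iff.1 (hedge i hi).2.1 (some e) }
  have hF : ∀ i < n, ∃ F, O.IsElimination f (-restrict (P i)) (restrict (P (i + 1))) F := by
    intro i hi
    have hc := hpath.comodular i hi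
    have h1 : restrict (P i) f = s := hconst i hi.le
    have h2 : restrict (P (i + 1)) f = s := hconst (i + 1) hi
    exact O.exists_isElimination (O.neg_mem _ hc.1) hc.2.1 (fun h => hc.ne (neg_inj.1 h))
      (by simp [h1, hs0]) (by simp [h1, h2])
  choose! F hF using hF
  -- At `p` any value is allowed, because `-P i` and `P (i + 1)` have opposite signs there.
  have hF' : ∀ i < n, O'.IsElimination (some f) (-P i) (P (i + 1))
      (extend (F i) (lexLocalization l (F i))) := by
    intro i hi
    have hFi := isElimination_iff.1 (hF i hi)
    refine isElimination_iff.2 ⟨hext.2.2 _ hFi.1, hFi.2.1, fun x hx => ?_⟩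
    cases x with
    | none =>
      rw [Pi.neg_apply, hPp i hi.le, hPp (i + 1) hi]
      revert hx
      generalize extend (F i) (lexLocalization l (F i)) none = a
      decide +revert
    | some e => exact hFi.2.2 e hx
  have hswap : ∀ i < n, ∀ Z, O'.IsElimination none (-P i) (P (i + 1)) Z →
      Z (some f) = -(s * lexLocalization l (F i)) := fun i hi Z hZ =>
    (hedge i hi).apply_elimination hs0 (hconst i hi.le) (hconst (i + 1) hi) hZ (hF' i hi)
  have hlex : ∀ i : Fin n, lexLocalization l (F i) = 0 := by
    refine lexLocalization_eq_zero (F := fun i : Fin n => F i) (t := -s) (fun e t ht he i => ?_) hl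
      (by simpa using hs0) fun i hi => ?_
    · exact hO.elimination_apply_eq_zero hpath hs0 ht hconst hF (fun i hi => he ⟨i, hi⟩) i i.2
    · have h1 := hswap i i.2 _ (hZ i i.2)
      have h2 := hZf i i.2
      rw [h1] at h2
      revert hi hs0 h2
      generalize lexLocalization l (F i) = a
      clear * -
      decide +revert
  have := hswap m hm Zm hZm
  rw [hlex ⟨m, hm⟩, hZmf] at this
  simp at this
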